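/- Let $n\ge 1$ and let $(M,\nabla_M)$ be a complete affine manifold (a manifold with a flat, torsion-free, geodesically complete connection; equivalently an atlas with locally affine changes of charts) that is diffeomorphic to the torus $T^n$. Equip $\mathrm{aff}(\mathbb R^n)=\mathfrak{gl}(n,\mathbb R)\times\mathbb R^n$ with the associative product $(C,c)\cdot(D,d)=(CD,Cd)$. Suppose that the affine structure of $M$ is defined by a commutative associative subalgebra $\mathcal H\subset \mathrm{aff}(\mathbb R^n)$. This means: there is $x_0\in\mathbb R^n$ such that $(C,c)\mapsto Cx_0+c$ is a bijection $\mathcal H\to\mathbb R^n$, and $M$ is the quotient of the group $H=(\mathcal H,+)$ by a lattice with a basis $(C_1,c_1),\dots,(C_n,c_n)$, where $H$ acts on $\mathbb R^n$ through $\exp$ and carries the affine structure with developing map $Y\mapsto \exp(Y)\cdot x_0$; thus $\pi_1(M)$ is generated by the $\gamma_i=\exp((C_i,c_i))$. Suppose moreover that $\mathcal H$ is rational, that is, the $\mathbb Q$-vector space spanned by $(C_1,c_1),\dots,(C_n,c_n)$ is stable under the product. Then there is a parallel action of the circle $S^1$ on $(M,\nabla_M)$: a smooth effective action of $S^1$ on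 $M$ whose infinitesimal generator is a parallel vector field. -/

import Mathlib

open scoped Manifold ContDiff Topology

noncomputable section

/-- The model space `ℝⁿ`. -/
abbrev Rn (n : ℕ) : Type := EuclideanSpace ℝ (Fin n)

/-- The pregroupoid of maps that are locally restrictions of affine maps of `ℝⁿ`. -/
def affinePregroupoid (n : ℕ) : Pregroupoid (Rn n) where
  property f s := ∀ x ∈ s, ∃ a : Rn n →ᵃ[ℝ] Rn n, ∀ᶠ y in 𝓝[s] x, f y = a y
  comp := by
    intro f g u v hf hg _ _ _ x hx
    obtain ⟨a, ha⟩ := hf x hx.1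
    obtain ⟨b, hb⟩ := hg (f x) hx.2
    refine ⟨b.comp a, ?_⟩
    have hfx : f x = a x := ha.self_of_nhdsWithin hx.1
    have ha' : ∀ᶠ y in 𝓝[u ∩ f ⁻¹' v] x, f y = a y :=
      ha.filter_mono (nhdsWithin_mono _ Set.inter_subset_left)
    have hac : Filter.Tendsto a (𝓝[u ∩ f ⁻¹' v] x) (𝓝 (f x)) := by
      rw [hfx]
      exact (a.continuous_of_finiteDimensional.tendsto x).mono_left nhdsWithin_le_nhds
    have hfc : Filter.Tendsto f (𝓝[u ∩ f ⁻¹' v] x) (𝓝[v] (f x)) := by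
      refine tendsto_nhdsWithin_iff.2 ⟨hac.congr' ?_, ?_⟩
      · filter_upwards [ha'] with y hy using hy.symm
      · filter_upwards [self_mem_nhdsWithin] with y hy using hy.2
    filter_upwards [ha', hfc.eventually hb] with y h1 h2
    simp only [Function.comp_apply, AffineMap.comp_apply]
    rw [h2, h1]
  id_mem := fun _ _ => ⟨AffineMap.id ℝ _, by simp⟩
  locality := by
    intro f u _ h x hx
    obtain ⟨v, hv, hxv, h'⟩ := h x hx
    obtain ⟨a, ha⟩ := h' x ⟨hx, hxv⟩
    refine ⟨a, ?_⟩
    rwa [nhdsWithin_inter_of_mem' (mem_nhdsWithin_of_mem_nhds (hv.mem_nhds hxv))] at ha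
  congr := by
    intro f g u _ h hf x hx
    obtain ⟨a, ha⟩ := hf x hx
    refine ⟨a, ?_⟩
    filter_upwards [ha, self_mem_nhdsWithin] with y h1 h2
    rw [h y h2, h1]

/-- The groupoid of locally affine partial homeomorphisms of `ℝⁿ`. An affine manifold of
dimension `n` (a manifold with a flat torsion-free connection `∇`) is a manifold with an atlas
whose changes of charts lie in this groupoid; in each chart of the atlas `∇` is the standard
connection of `ℝⁿ`. -/
def affineGroupoid (n : ℕ) : StructureGroupoid (Rn n) :=
  (affinePregroupoid n).groupoid

/-- A curve `ℝ → M` is a geodesic of the affine manifold `M` if it is locally of the form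
`s ↦ p + (s - t) v` in the affine charts. -/
def IsAffineGeodesic (n : ℕ) {M : Type*} [TopologicalSpace M] [ChartedSpace (Rn n) M]
    (c : ℝ → M) : Prop :=
  ∀ t : ℝ, ∀ e ∈ atlas (Rn n) M, c t ∈ e.source →
    ∃ v : Rn n, ∀ᶠ s in 𝓝 t, c s ∈ e.source ∧ e (c s) = e (c t) + (s - t) • v

/-- Geodesic completeness: for each point and each initial velocity there is a geodesic
defined on all of `ℝ`. -/
def IsAffineComplete (n : ℕ) (M : Type*) [TopologicalSpace M] [ChartedSpace (Rn n) M] : Prop :=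
  ∀ e ∈ atlas (Rn n) M, ∀ x ∈ e.source, ∀ v : Rn n, ∃ c : ℝ → M,
    IsAffineGeodesic n c ∧ c 0 = x ∧ HasDerivAt (fun s => e (c s)) v 0

/-- The vector space `aff(ℝⁿ)` of pairs `(C, c)`. The pair `(C, c)` is the affine vector field
`x ↦ C x + c`. -/
abbrev AffLie (n : ℕ) : Type := (Rn n →L[ℝ] Rn n) × Rn n

/-- The associative product `(C, c) · (D, d) = (C D, C d)` of `aff(ℝⁿ)`. -/
def affMul {n : ℕ} (X Y : AffLie n) : AffLie n := (X.1.comp Y.1, X.1 Y.2)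

/-- `(C, c)` as the endomorphism `(x, t) ↦ (C x + t c, 0)` of `ℝⁿ × ℝ`, that is, the block
matrix with rows `(C, c)` and `(0, 0)`. -/
def affLift {n : ℕ} (X : AffLie n) : (Rn n × ℝ) →L[ℝ] (Rn n × ℝ) :=
  (X.1.comp (ContinuousLinearMap.fst ℝ (Rn n) ℝ) +
    (ContinuousLinearMap.snd ℝ (Rn n) ℝ).smulRight X.2).prod 0

/-- The affine transformation `exp (C, c)` of `ℝⁿ`, where `ℝⁿ` is the hyperplane `t = 1` of
`ℝⁿ × ℝ`. -/
def affExp {n : ℕ} (X : AffLie n) (x : Rn n) : Rn n :=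
  (NormedSpace.exp (affLift X) (x, 1)).1

/-- The affine structure of `M` is defined by the commutative associative subalgebra `𝓗` of
`aff(ℝⁿ)`, and `exp (X 0), …, exp (X (n - 1))` are generators `γ₁, …, γₙ` of `π₁(M)`.

Here `(𝓗, +)` is the simply connected commutative Lie group `H` with Lie algebra `𝓗`; it acts on
`ℝⁿ` through `exp`, and `M` is the quotient of `H` by the lattice with basis `X`. The point `x₀` has
an open orbit, so `Y ↦ exp Y · x₀` is a local diffeomorphism from `H` to `ℝⁿ`, and it is
the developing map of `M`. -/
structure IsDefinedByAlgebra (n : ℕ) (M : Type*) [TopologicalSpace M] [ChartedSpace (Rn n) M]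
    (𝓗 : Submodule ℝ (AffLie n)) (X : Fin n → AffLie n) : Prop where
  mul_mem : ∀ Y ∈ 𝓗, ∀ Z ∈ 𝓗, affMul Y Z ∈ 𝓗
  mul_comm : ∀ Y ∈ 𝓗, ∀ Z ∈ 𝓗, affMul Y Z = affMul Z Y
  linearIndependent : LinearIndependent ℝ X
  span_eq : Submodule.span ℝ (Set.range X) = 𝓗
  exists_developing : ∃ (x₀ : Rn n) (P : 𝓗 → M),
    -- the infinitesimal action of `𝓗` is simply transitive at `x₀`
    (Function.Bijective fun Y : 𝓗 => Y.1.1 x₀ + Y.1.2) ∧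
    -- `P` is the projection of `H` onto its quotient by the lattice
    Function.Surjective P ∧
    (∀ Y Z : 𝓗, P Y = P Z ↔ ∃ m : Fin n → ℤ, Z.1 - Y.1 = ∑ i, (m i : ℝ) • X i) ∧
    -- in affine charts of `M` the projection is the developing map up to an affine isomorphism
    (∀ Y : 𝓗, ∀ e ∈ atlas (Rn n) M, P Y ∈ e.source → ∃ a : Rn n ≃ᵃ[ℝ] Rn n,
      ∀ᶠ Z in 𝓝 Y, P Z ∈ e.source ∧ e (P Z) = a (affExp Z.1 x₀))

/-- The `ℚ`-vector space generated by `X 0, …, X (n - 1)`. -/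
def ratSpan {n : ℕ} (X : Fin n → AffLie n) : Set (AffLie n) :=
  Set.range fun q : Fin n → ℚ => ∑ i, (q i : ℝ) • X i

/-- Rationality: the `ℚ`-vector space generated by the logarithms of generators of `π₁(M)` is
stable under the associative product. -/
def IsRationalAlgebra {n : ℕ} (X : Fin n → AffLie n) : Prop :=
  ∀ Y ∈ ratSpan X, ∀ Z ∈ ratSpan X, affMul Y Z ∈ ratSpan X

/-- A parallel action of the circle on the affine manifold `M`: a smooth effective action whose
infinitesimal generator is a parallel vector field, that is, a vector field whose expression in
each affine chart is locally constant. -/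
structure IsParallelCircleAction (n : ℕ) (M : Type*) [TopologicalSpace M]
    [ChartedSpace (Rn n) M] [MulAction Circle M] : Prop where
  smooth : ContMDiff ((𝓡 1).prod (𝓡 n)) (𝓡 n) ∞ fun q : Circle × M => q.1 • q.2
  effective : FaithfulSMul Circle M
  parallel : ∀ e ∈ atlas (Rn n) M, ∀ x ∈ e.source, ∃ v : Rn n, ∀ᶠ y in 𝓝 x,
    HasDerivAt (fun θ : ℝ => e (Circle.exp θ • y)) v 0

end

/-! Suppose `Z ∈ 𝓗` satisfies `Y Z = 0` for every `Y ∈ 𝓗`. Then `exp (Y + r Z) = exp Y (1 + r Z) =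
exp Y + r Z`, so the developing map `Y ↦ exp Y · x₀` turns translation by `r Z` into translation by
a fixed vector times `r`. These translations descend to `M` and have a parallel generator. If
moreover `Z` is a primitive lattice vector, they form an effective circle action
(`IsDevelopedBy.exists_isParallelCircleAction`).

Such a `Z` is found in three steps. Completeness makes the developing map surjective: geodesics of
`M` lift to `𝓗` and develop onto straight lines (`IsDevelopedBy.surjective_of_isAffineComplete`).
Surjectivity forces every element of `𝓗` to be nilpotent (`isNilpotent_affLift_of_surjective`).
Commuting nilpotents that preserve the rational span of the lattice have a common nonzero
annihilator there, and rescaling makes it primitive (`exists_unimodular_annihilator`). -/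

/-! ### Exponentials in real Banach algebras. -/

theorem NormedSpace.exp_mul_eq_self_of_mul_eq_zero {R : Type*} [NormedRing R] [NormedAlgebra ℝ R]
    [CompleteSpace R] {a b : R} (h : a * b = 0) : NormedSpace.exp a * b = b := by
  have hs := (NormedSpace.exp_series_hasSum_exp' (𝕂 := ℝ) a).mul_right b
  refine (hs.unique (hasSum_single 0 fun k hk => ?_)).trans (by simp)
  obtain ⟨k, rfl⟩ := Nat.exists_eq_succ_of_ne_zero hk
  simp [pow_succ, mul_assoc, h]

theorem NormedSpace.mul_exp_eq_self_of_mul_eq_zero {R : Type*} [NormedRing R] [NormedAlgebra ℝ R]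
    [CompleteSpace R] {a b : R} (h : b * a = 0) : b * NormedSpace.exp a = b := by
  have hs := (NormedSpace.exp_series_hasSum_exp' (𝕂 := ℝ) a).mul_left b
  refine (hs.unique (hasSum_single 0 fun k hk => ?_)).trans (by simp)
  obtain ⟨k, rfl⟩ := Nat.exists_eq_succ_of_ne_zero hk
  simp [pow_succ', ← mul_assoc, h]

theorem NormedSpace.exp_eq_one_add_of_mul_self_eq_zero {R : Type*} [NormedRing R]
    [NormedAlgebra ℝ R] [CompleteSpace R] {a : R} (h : a * a = 0) :
    NormedSpace.exp a = 1 + a := by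
  have hs := NormedSpace.exp_series_hasSum_exp' (𝕂 := ℝ) a
  refine (hs.unique (hasSum_sum_of_ne_finset_zero (s := Finset.range 2) fun k hk => ?_)).trans
    (by simp [Finset.sum_range_succ])
  obtain ⟨k, rfl⟩ := Nat.exists_eq_add_of_le' (not_lt.1 fun h => hk (Finset.mem_range.2 h))
  simp [pow_succ, mul_assoc, h]

theorem NormedSpace.exp_add_of_commute_real {R : Type*} [NormedRing R] [NormedAlgebra ℝ R]
    [CompleteSpace R] {a b : R} (h : Commute a b) :
    NormedSpace.exp (a + b) = NormedSpace.exp a * NormedSpace.exp b :=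
  letI := NormedAlgebra.restrictScalars ℚ ℝ R
  NormedSpace.exp_add_of_commute h

theorem NormedSpace.isUnit_exp_real {R : Type*} [NormedRing R] [NormedAlgebra ℝ R]
    [CompleteSpace R] (a : R) : IsUnit (NormedSpace.exp a) :=
  letI := NormedAlgebra.restrictScalars ℚ ℝ R
  NormedSpace.isUnit_exp a

/-! ### Common annihilators and primitive integer vectors. -/

/-- In a ring, finitely many commuting nilpotent elements have a common nonzero annihilator in
every set that is stable under multiplication by these elements. -/
theorem exists_ne_zero_forall_mul_eq_zero {R ι : Type*} [Ring R] [Finite ι] (A : Set R)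
    (x : ι → R) (hA : ∀ i, ∀ a ∈ A, x i * a ∈ A) (hx : ∀ i, IsNilpotent (x i))
    (hcomm : ∀ i j, Commute (x i) (x j)) (hne : ∃ a ∈ A, a ≠ 0) :
    ∃ z ∈ A, z ≠ 0 ∧ ∀ i, x i * z = 0 := by
  classical
  have := Fintype.ofFinite ι
  suffices h : ∀ s : Finset ι, ∃ z ∈ A, z ≠ 0 ∧ ∀ i ∈ s, x i * z = 0 by
    simpa using h Finset.univ
  intro s
  induction s using Finset.induction_on with
  | empty => simpa using hne
  | insert j s _ ih =>
    obtain ⟨z, hzA, hz, hs⟩ := ih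
    have hex : ∃ k, x j ^ k * z = 0 := by
      obtain ⟨k, hk⟩ := hx j
      exact ⟨k, by simp [hk]⟩
    have hpow : ∀ k, x j ^ k * z ∈ A := by
      intro k
      induction k with
      | zero => simpa using hzA
      | succ k ih => rw [pow_succ', mul_assoc]; exact hA _ _ ih
    -- The least exponent killing `z` is positive because `z ≠ 0`; one power less gives a nonzero
    -- element killed by `x j`.
    obtain ⟨k, hk⟩ : ∃ k, Nat.find hex = k + 1 := by
      refine Nat.exists_eq_succ_of_ne_zero fun h0 => hz ?_
      simpa [h0] using Nat.find_spec hex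
    refine ⟨x j ^ k * z, hpow k, Nat.find_min hex (by omega), fun i hi => ?_⟩
    rcases Finset.mem_insert.1 hi with rfl | hi
    · rw [← mul_assoc, ← pow_succ', ← hk]
      exact Nat.find_spec hex
    · rw [← mul_assoc, ((hcomm i j).pow_right k).eq, mul_assoc, hs i hi, mul_zero]

/-- A nonzero rational vector is proportional to a unimodular integer vector. -/
theorem exists_unimodular_eq_mul {ι : Type*} [Fintype ι] (q : ι → ℚ) (hq : q ≠ 0) :
    ∃ (r : ℚ) (m a : ι → ℤ), r ≠ 0 ∧ (∀ i, (m i : ℚ) = r * q i) ∧ ∑ i, a i * m i = 1 := by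
  obtain ⟨b, hb⟩ := IsLocalization.exist_integer_multiples_of_finite (nonZeroDivisors ℤ) q
  choose p hp using hb
  obtain ⟨i₀, hi₀⟩ := Function.ne_iff.1 hq
  have hb0 : ((b : ℤ) : ℚ) ≠ 0 := by exact_mod_cast nonZeroDivisors.coe_ne_zero b
  have hp' : ∀ i, (p i : ℚ) = (b : ℤ) * q i := by
    intro i
    simpa [zsmul_eq_mul] using hp i
  have hpi : p i₀ ≠ 0 := by
    intro h
    have := hp' i₀
    rw [h, Int.cast_zero] at this
    exact (mul_ne_zero hb0 hi₀) this.symm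
  -- After clearing denominators, division by the gcd gives `m`; the Bézout coefficients `a` certify
  -- that it is primitive.
  obtain ⟨m, hm, hg⟩ := Finset.extract_gcd p (s := Finset.univ) ⟨i₀, Finset.mem_univ _⟩
  obtain ⟨a, ha⟩ := Finset.gcd_eq_sum_mul Finset.univ m
  have hg0 : ((Finset.univ.gcd p : ℤ) : ℚ) ≠ 0 := by
    norm_cast
    intro h
    exact hpi (Finset.gcd_eq_zero_iff.1 h i₀ (Finset.mem_univ _))
  refine ⟨((b : ℤ) : ℚ) / (Finset.univ.gcd p : ℤ), m, a, div_ne_zero hb0 hg0, fun i => ?_, ?_⟩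
  · have h1 : (p i : ℚ) = (Finset.univ.gcd p : ℤ) * m i := by
      exact_mod_cast hm i (Finset.mem_univ _)
    rw [div_mul_eq_mul_div, eq_div_iff hg0, ← hp', h1, mul_comm]
  · rw [← hg, ha]
    exact Finset.sum_congr rfl fun i _ => mul_comm _ _

/-! ### The block-matrix representation of affine vector fields. -/

/-- `affLift` as a linear map. -/
noncomputable def affLiftLinear (n : ℕ) :
    AffLie n →ₗ[ℝ] ((Rn n × ℝ) →L[ℝ] (Rn n × ℝ)) where
  toFun := affLift
  map_add' X Y := by
    ext v <;> simp [affLift]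
  map_smul' r X := by
    ext v <;> simp [affLift]

theorem affLift_apply {n : ℕ} (X : AffLie n) (v : Rn n × ℝ) :
    affLift X v = (X.1 v.1 + v.2 • X.2, 0) := rfl

theorem affLift_add {n : ℕ} (X Y : AffLie n) : affLift (X + Y) = affLift X + affLift Y :=
  (affLiftLinear n).map_add X Y

theorem affLift_smul {n : ℕ} (r : ℝ) (X : AffLie n) : affLift (r • X) = r • affLift X :=
  (affLiftLinear n).map_smul r X

theorem affLift_mul {n : ℕ} (X Y : AffLie n) : affLift (affMul X Y) = affLift X * affLift Y := by
  refine ContinuousLinearMap.ext fun v => ?_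
  rw [mul_apply_eq_comp]
  simp [affLift_apply, affMul]

theorem affLift_injective {n : ℕ} : Function.Injective (affLift (n := n)) := by
  intro X Y h
  have key : ∀ v : Rn n × ℝ, X.1 v.1 + v.2 • X.2 = Y.1 v.1 + v.2 • Y.2 := fun v => by
    simpa [affLift_apply] using congrArg Prod.fst (DFunLike.congr_fun h v)
  refine Prod.ext (ContinuousLinearMap.ext fun x => ?_) ?_
  · simpa using key (x, 0)
  · simpa using key (0, 1)

theorem affLift_ne_zero {n : ℕ} {X : AffLie n} (hX : X ≠ 0) : affLift X ≠ 0 := fun h =>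
  hX (affLift_injective (h.trans ((affLiftLinear n).map_zero).symm))

theorem exp_affLift_apply_snd {n : ℕ} (X : AffLie n) (v : Rn n × ℝ) :
    (NormedSpace.exp (affLift X) v).2 = v.2 := by
  -- The projection to the last coordinate kills the image of `affLift X`, hence is unchanged by
  -- right multiplication with the exponential.
  let C : (Rn n × ℝ) →L[ℝ] (Rn n × ℝ) :=
    (0 : (Rn n × ℝ) →L[ℝ] Rn n).prod (ContinuousLinearMap.snd ℝ (Rn n) ℝ)
  have hC : C * affLift X = 0 := by
    refine ContinuousLinearMap.ext fun w => ?_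
    rw [mul_apply_eq_comp]
    simp [C, affLift_apply]
  have := DFunLike.congr_fun (NormedSpace.mul_exp_eq_self_of_mul_eq_zero hC) v
  rw [mul_apply_eq_comp] at this
  have h2 : (C (NormedSpace.exp (affLift X) v)).2 = (C v).2 := by rw [this]
  exact h2

theorem exp_affLift_apply {n : ℕ} (X : AffLie n) (x : Rn n) :
    NormedSpace.exp (affLift X) (x, 1) = (affExp X x, 1) :=
  Prod.ext rfl (exp_affLift_apply_snd X (x, 1))

/-- Translation by an element that annihilates `Y` and itself. -/
theorem affExp_add_of_affMul_eq_zero {n : ℕ} {Y Z : AffLie n} (hYZ : affMul Y Z = 0)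
    (hZY : affMul Z Y = 0) (hZ : affMul Z Z = 0) (x : Rn n) :
    affExp (Y + Z) x = affExp Y x + (Z.1 x + Z.2) := by
  have h0 : affLift (0 : AffLie n) = 0 := (affLiftLinear n).map_zero
  have h1 : affLift Y * affLift Z = 0 := by rw [← affLift_mul, hYZ, h0]
  have h2 : affLift Z * affLift Y = 0 := by rw [← affLift_mul, hZY, h0]
  have h3 : affLift Z * affLift Z = 0 := by rw [← affLift_mul, hZ, h0]
  have hc : Commute (affLift Y) (affLift Z) := h1.trans h2.symm
  have : NormedSpace.exp (affLift (Y + Z)) = NormedSpace.exp (affLift Y) + affLift Z := by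
    rw [affLift_add, NormedSpace.exp_add_of_commute_real hc,
      NormedSpace.exp_eq_one_add_of_mul_self_eq_zero h3, mul_add, mul_one,
      NormedSpace.exp_mul_eq_self_of_mul_eq_zero h1]
  simp [affExp, this, affLift_apply]

/-- The value at `x` of the affine vector fields in `𝓗`. -/
noncomputable def affEval {n : ℕ} (𝓗 : Submodule ℝ (AffLie n)) (x : Rn n) : 𝓗 →ₗ[ℝ] Rn n where
  toFun Y := Y.1.1 x + Y.1.2
  map_add' Y Z := by simp; abel
  map_smul' r Y := by simp

theorem affLift_apply_one {n : ℕ} {𝓗 : Submodule ℝ (AffLie n)} (x : Rn n) (Y : 𝓗) :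
    affLift Y.1 (x, 1) = (affEval 𝓗 x Y, 0) := by
  simp [affLift_apply, affEval]

theorem commute_affLift {n : ℕ} {Y Z : AffLie n} (h : affMul Y Z = affMul Z Y) :
    Commute (affLift Y) (affLift Z) := by
  rw [Commute, SemiconjBy, ← affLift_mul, ← affLift_mul, h]

theorem eq_zero_of_isUnit_apply_eq_zero {E : Type*} [NormedAddCommGroup E] [NormedSpace ℝ E]
    {a : E →L[ℝ] E} (ha : IsUnit a) {v : E} (h : a v = 0) : v = 0 := by
  obtain ⟨u, rfl⟩ := ha
  have h3 : ((↑u⁻¹ * ↑u : E →L[ℝ] E)) v = 0 := by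
    rw [mul_apply_eq_comp, h, map_zero]
  simpa using h3

/-! ### Differentiating the exponential along a commuting linear family. -/

section ExpLinear

variable {V A E F : Type*} [NormedAddCommGroup V] [NormedSpace ℝ V]
  [NormedRing A] [NormedAlgebra ℝ A] [CompleteSpace A]
  [NormedAddCommGroup E] [NormedSpace ℝ E] [CompleteSpace E]
  [NormedAddCommGroup F] [NormedSpace ℝ F]

/-- Commutativity gives `exp (L W) = exp (L Y) * exp (L (W - Y))`, which reduces the derivative at
`Y` to the one at `0`. -/
theorem hasFDerivAt_exp_comp_of_commute (L : V →L[ℝ] A)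
    (hL : ∀ Y Z, Commute (L Y) (L Z)) (Y : V) :
    HasFDerivAt (fun Y => NormedSpace.exp (L Y))
      ((ContinuousLinearMap.mul ℝ A (NormedSpace.exp (L Y))).comp L) Y := by
  have h0 : HasFDerivAt (fun W => NormedSpace.exp (L W)) L 0 := by
    have h1 : HasFDerivAt (NormedSpace.exp : A → A) (1 : A →L[ℝ] A) (L 0) := by
      rw [map_zero]
      exact hasFDerivAt_exp_zero
    exact h1.comp (0 : V) L.hasFDerivAt
  have h1 : HasFDerivAt (fun W => NormedSpace.exp (L (W - Y))) L Y := by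
    have h2 : HasFDerivAt (fun W => NormedSpace.exp (L W)) L (Y - Y) := by rwa [sub_self]
    exact HasFDerivAt.comp (f := fun W => W - Y) Y h2 ((hasFDerivAt_id Y).sub_const Y)
  have h2 := (ContinuousLinearMap.mul ℝ A (NormedSpace.exp (L Y))).hasFDerivAt.comp Y h1
  refine h2.congr_of_eventuallyEq (Filter.Eventually.of_forall fun W => ?_)
  simp only [Function.comp_apply, ContinuousLinearMap.mul_apply']
  rw [← NormedSpace.exp_add_of_commute_real (hL _ _), ← map_add, add_sub_cancel]

theorem contDiff_exp_comp (L : V →L[ℝ] A) : ContDiff ℝ ∞ fun Y => NormedSpace.exp (L Y) :=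
  (AnalyticOnNhd.contDiff fun a _ => NormedSpace.exp_analytic (𝕂 := ℝ) a).comp L.contDiff

theorem contDiff_exp_apply [FiniteDimensional ℝ V] (L : V →ₗ[ℝ] (E →L[ℝ] E)) (p : E →L[ℝ] F)
    (v : E) : ContDiff ℝ ∞ fun Y => p (NormedSpace.exp (L Y) v) :=
  p.contDiff.comp ((contDiff_exp_comp (LinearMap.toContinuousLinearMap L)).clm_apply contDiff_const)

theorem exists_hasFDerivAt_exp_apply [FiniteDimensional ℝ V] (L : V →ₗ[ℝ] (E →L[ℝ] E))
    (hL : ∀ Y Z, Commute (L Y) (L Z)) (p : E →L[ℝ] F) (v : E) (Y : V) :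
    ∃ D : V →L[ℝ] F, HasFDerivAt (fun Y => p (NormedSpace.exp (L Y) v)) D Y ∧
      ∀ W, D W = p (NormedSpace.exp (L Y) (L W v)) := by
  have h := hasFDerivAt_exp_comp_of_commute (LinearMap.toContinuousLinearMap L) hL Y
  exact ⟨_, (p.comp (ContinuousLinearMap.apply ℝ E v)).hasFDerivAt.comp Y h, fun W => rfl⟩

end ExpLinear

/-- The linear combinations of a family in `aff(ℝⁿ)`. -/
noncomputable def affComb {n : ℕ} (X : Fin n → AffLie n) : (Fin n → ℝ) →ₗ[ℝ] AffLie n :=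
  Fintype.linearCombination ℝ X

theorem affComb_apply {n : ℕ} (X : Fin n → AffLie n) (t : Fin n → ℝ) :
    affComb X t = ∑ i, t i • X i :=
  Fintype.linearCombination_apply ℝ X t

theorem contDiff_affExp_affComb {n : ℕ} (X : Fin n → AffLie n) (x : Rn n) :
    ContDiff ℝ ∞ fun t => affExp (affComb X t) x :=
  contDiff_exp_apply ((affLiftLinear n).comp (affComb X)) (ContinuousLinearMap.fst ℝ (Rn n) ℝ) (x, 1)

/-- If the span of `X` is commutative and infinitesimally simply transitive at `x`, then
`t ↦ exp (∑ i, t i • X i) · x` has invertible derivatives. -/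
theorem exists_hasFDerivAt_affExp_affComb {n : ℕ} {X : Fin n → AffLie n} {x : Rn n}
    (hcomm : ∀ s t, affMul (affComb X s) (affComb X t) = affMul (affComb X t) (affComb X s))
    (hx : ∀ t, (affComb X t).1 x + (affComb X t).2 = 0 → t = 0) (t : Fin n → ℝ) :
    ∃ D : (Fin n → ℝ) ≃L[ℝ] Rn n,
      HasFDerivAt (fun t => affExp (affComb X t) x) (D : (Fin n → ℝ) →L[ℝ] Rn n) t := by
  obtain ⟨D, hD, hDapp⟩ := exists_hasFDerivAt_exp_apply ((affLiftLinear n).comp (affComb X))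
    (fun s t => commute_affLift (hcomm s t)) (ContinuousLinearMap.fst ℝ (Rn n) ℝ) (x, 1) t
  have hinj : Function.Injective D := by
    rw [injective_iff_map_eq_zero]
    intro s hs
    rw [hDapp] at hs
    -- The exponential preserves the last coordinate, here `0`, so vanishing of the first component
    -- is vanishing of the whole vector.
    have h1 : NormedSpace.exp (affLift (affComb X t)) (affLift (affComb X s) (x, 1)) = 0 :=
      Prod.ext hs (exp_affLift_apply_snd _ _)
    have h2 := eq_zero_of_isUnit_apply_eq_zero (NormedSpace.isUnit_exp_real _) h1
    refine hx s ?_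
    simpa [affLift_apply] using congrArg (fun w : Rn n × ℝ => w.1) h2
  have hfin : Module.finrank ℝ (Fin n → ℝ) = Module.finrank ℝ (Rn n) := by simp
  exact ⟨((D : (Fin n → ℝ) →ₗ[ℝ] Rn n).linearEquivOfInjective hinj hfin).toContinuousLinearEquiv,
    hD⟩

/-! ### Surjectivity of the orbit map forces nilpotency. -/

/-- The lift of `𝓗` need not contain the identity, so only polynomials without constant term in `Y`
are sure to stay in it; hence the extra factor `affLift Y.1`. -/
theorem affLift_mul_aeval_mem {n : ℕ} {𝓗 : Submodule ℝ (AffLie n)}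
    (hmul : ∀ Y ∈ 𝓗, ∀ Z ∈ 𝓗, affMul Y Z ∈ 𝓗) (Y : 𝓗) (p : Polynomial ℝ) :
    ∃ Z : 𝓗, affLift Z.1 = affLift Y.1 * Polynomial.aeval (affLift Y.1) p := by
  induction p using Polynomial.induction_on with
  | C a => exact ⟨a • Y, by simp [affLift_smul, Algebra.algebraMap_eq_smul_one]⟩
  | add p q hp hq =>
    obtain ⟨Z, hZ⟩ := hp
    obtain ⟨W, hW⟩ := hq
    exact ⟨Z + W, by simp [affLift_add, hZ, hW, mul_add]⟩
  | monomial k a h =>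
    obtain ⟨Z, hZ⟩ := h
    refine ⟨⟨affMul Z.1 Y.1, hmul _ Z.2 _ Y.2⟩, ?_⟩
    simp only [affLift_mul, hZ]
    rw [pow_succ, ← mul_assoc, map_mul _ _ Polynomial.X, Polynomial.aeval_X, mul_assoc]

/-- If the orbit map of the commutative algebra `𝓗` is surjective, then `𝓗` consists of nilpotent
elements. -/
theorem isNilpotent_affLift_of_surjective {n : ℕ} {𝓗 : Submodule ℝ (AffLie n)} {x : Rn n}
    (hmul : ∀ Y ∈ 𝓗, ∀ Z ∈ 𝓗, affMul Y Z ∈ 𝓗)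
    (hcomm : ∀ Y ∈ 𝓗, ∀ Z ∈ 𝓗, affMul Y Z = affMul Z Y)
    (hx : Function.Injective (affEval 𝓗 x))
    (hsurj : Function.Surjective fun Y : 𝓗 => affExp Y.1 x) (Y : 𝓗) :
    IsNilpotent (affLift Y.1) := by
  set L := affLift Y.1 with hLdef
  obtain ⟨p, hp0, hp⟩ : IsAlgebraic ℝ L := (Algebra.IsIntegral.isIntegral L).isAlgebraic
  obtain ⟨q, hpq, hq⟩ := Polynomial.exists_eq_pow_rootMultiplicity_mul_and_not_dvd p hp0 0
  set k := p.rootMultiplicity 0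
  rw [Polynomial.C_0, sub_zero] at hpq hq
  have hq0 : q.coeff 0 ≠ 0 := fun h => hq (Polynomial.X_dvd_iff.2 h)
  -- Since `q = X * q.divX + q.coeff 0`, this `W` satisfies `q(L) = q(0) (1 + W)`. The power `L ^ (k
  -- + 1)`, unlike `L ^ k`, comes from `𝓗` even when `k = 0`.
  obtain ⟨W, hW⟩ := affLift_mul_aeval_mem hmul Y (Polynomial.C (q.coeff 0)⁻¹ * q.divX)
  obtain ⟨V, hV⟩ := affLift_mul_aeval_mem hmul Y (Polynomial.X ^ k)
  have hVL : affLift V.1 = L ^ (k + 1) := by simp [hV, pow_succ', hLdef]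
  have hqW : Polynomial.aeval L q = q.coeff 0 • (1 + affLift W.1) := by
    conv_lhs => rw [← Polynomial.X_mul_divX_add q]
    rw [hW]
    simp only [map_add, map_mul, Polynomial.aeval_X, Polynomial.aeval_C, smul_add, ← hLdef,
      Algebra.algebraMap_eq_smul_one, smul_mul_assoc, one_mul, mul_smul_comm]
    rw [smul_smul, mul_inv_cancel₀ hq0, one_smul, add_comm]
  have hkill : affLift V.1 * (1 + affLift W.1) = 0 := by
    have h1 : L ^ k * (q.coeff 0 • (1 + affLift W.1)) = 0 := by
      rw [← hqW, ← hp]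
      conv_rhs => rw [hpq]
      simp
    have h2 := (smul_eq_zero.1 ((Algebra.mul_smul_comm _ _ _).symm.trans h1)).resolve_left hq0
    rw [hVL, pow_succ', mul_assoc, h2, mul_zero]
  -- On `(x, 1)` the possibly singular `1 + W` agrees with the invertible `exp Z`. As `V` commutes
  -- with `exp Z` and `V (1 + W) = 0`, it follows that `V` kills `(x, 1)`, hence `V = 0`.
  obtain ⟨Z, hZ⟩ := hsurj (x + affEval 𝓗 x W)
  have hexp : NormedSpace.exp (affLift Z.1) (x, 1) = (1 + affLift W.1) (x, 1) := by
    rw [exp_affLift_apply]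
    simp only at hZ
    rw [hZ, add_apply, one_apply_eq_self, affLift_apply_one]
    simp
  have hzero : affEval 𝓗 x V = 0 := by
    have hc : Commute (affLift V.1) (NormedSpace.exp (affLift Z.1)) :=
      (commute_affLift (hcomm _ V.2 _ Z.2)).exp_right
    have h1 : (NormedSpace.exp (affLift Z.1)) (affLift V.1 (x, 1)) = 0 := by
      rw [← mul_apply_eq_comp, ← hc.eq, mul_apply_eq_comp, hexp, ← mul_apply_eq_comp, hkill]
      rfl
    have h2 := eq_zero_of_isUnit_apply_eq_zero (NormedSpace.isUnit_exp_real _) h1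
    rw [affLift_apply_one] at h2
    exact congrArg (fun w : Rn n × ℝ => w.1) h2
  refine ⟨k + 1, ?_⟩
  rw [← hVL, (injective_iff_map_eq_zero _).1 hx V hzero]
  exact (affLiftLinear n).map_zero

/-! ### Smooth structure of affine manifolds and their developing maps. -/

theorem AffineMap.contDiff_of_finiteDimensional {V W : Type*} [NormedAddCommGroup V]
    [NormedSpace ℝ V] [FiniteDimensional ℝ V] [NormedAddCommGroup W] [NormedSpace ℝ W]
    (a : V →ᵃ[ℝ] W) {k : WithTop ℕ∞} : ContDiff ℝ k a :=
  ContinuousAffineMap.contDiff (⟨a, a.continuous_of_finiteDimensional⟩ : V →ᴬ[ℝ] W)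

theorem affineGroupoid_le_contDiffGroupoid (n : ℕ) :
    affineGroupoid n ≤ contDiffGroupoid ∞ (𝓡 n) := by
  refine groupoid_of_pregroupoid_le _ _ fun f s hf => ?_
  simp only [contDiffPregroupoid, modelWithCornersSelf_coe, modelWithCornersSelf_coe_symm,
    Function.comp_id, Function.id_comp, Set.preimage_id, Set.range_id, Set.inter_univ]
  intro x hx
  obtain ⟨a, ha⟩ := hf x hx
  exact a.contDiff_of_finiteDimensional.contDiffWithinAt.congr_of_eventuallyEq ha
    (ha.self_of_nhdsWithin hx)

theorem isManifold_of_hasGroupoid_affineGroupoid (n : ℕ) (M : Type*) [TopologicalSpace M]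
    [ChartedSpace (Rn n) M] [h : HasGroupoid M (affineGroupoid n)] : IsManifold (𝓡 n) ∞ M :=
  have : HasGroupoid M (contDiffGroupoid ∞ (𝓡 n)) :=
    hasGroupoid_of_le h (affineGroupoid_le_contDiffGroupoid n)
  IsManifold.mk' _ _ _

/-- `D` is a local diffeomorphism that expresses `P` in the affine charts of `M`, up to affine
isomorphisms. -/
structure IsDevelopedBy {n : ℕ} {M V : Type*} [TopologicalSpace M] [ChartedSpace (Rn n) M]
    [NormedAddCommGroup V] [NormedSpace ℝ V] (D : V → Rn n) (P : V → M) : Prop where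
  contDiff : ContDiff ℝ ∞ D
  exists_hasFDerivAt : ∀ Y, ∃ D' : V ≃L[ℝ] Rn n, HasFDerivAt D (D' : V →L[ℝ] Rn n) Y
  exists_affineEquiv : ∀ Y, ∀ e ∈ atlas (Rn n) M, P Y ∈ e.source → ∃ a : Rn n ≃ᵃ[ℝ] Rn n,
    ∀ᶠ Z in 𝓝 Y, P Z ∈ e.source ∧ e (P Z) = a (D Z)

namespace IsDevelopedBy

variable {n : ℕ} {M V : Type*} [TopologicalSpace M] [ChartedSpace (Rn n) M]
  [NormedAddCommGroup V] [NormedSpace ℝ V] {D : V → Rn n} {P : V → M}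

theorem contMDiff [IsManifold (𝓡 n) ∞ M] (h : IsDevelopedBy D P) :
    ContMDiff 𝓘(ℝ, V) (𝓡 n) ∞ P := by
  intro Y
  obtain ⟨a, ha⟩ := h.exists_affineEquiv Y _ (chart_mem_atlas (Rn n) (P Y))
    (mem_chart_source (Rn n) (P Y))
  have h1 : ContMDiffAt (𝓡 n) (𝓡 n) ∞ (chartAt (Rn n) (P Y)).symm (a (D Y)) := by
    refine contMDiffAt_symm_of_mem_maximalAtlas
      (IsManifold.chart_mem_maximalAtlas (I := 𝓡 n) (P Y)) ?_
    rw [← ha.self_of_nhds.2]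
    exact (chartAt (Rn n) (P Y)).map_source ha.self_of_nhds.1
  have h2 : ContDiff ℝ ∞ fun Z => a (D Z) :=
    (a : Rn n →ᵃ[ℝ] Rn n).contDiff_of_finiteDimensional.comp h.contDiff
  refine (ContMDiffAt.comp Y h1 h2.contDiffAt.contMDiffAt).congr_of_eventuallyEq ?_
  filter_upwards [ha] with Z hZ
  rw [Function.comp_apply, ← hZ.2, (chartAt (Rn n) (P Y)).left_inv hZ.1]

/-- In a chart `P` is `a ∘ D`, so the inverse function theorem for `D` supplies the section. -/
theorem exists_local_section [CompleteSpace V] [IsManifold (𝓡 n) ∞ M] (h : IsDevelopedBy D P)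
    (Y : V) :
    ∃ s : M → V, s (P Y) = Y ∧ ContMDiffAt (𝓡 n) 𝓘(ℝ, V) ∞ s (P Y) ∧
      (∀ᶠ y in 𝓝 (P Y), P (s y) = y) ∧ ∀ᶠ Z in 𝓝 Y, s (P Z) = Z := by
  set e := chartAt (Rn n) (P Y)
  have heY : P Y ∈ e.source := mem_chart_source (Rn n) (P Y)
  obtain ⟨a, ha⟩ := h.exists_affineEquiv Y e (chart_mem_atlas (Rn n) (P Y)) heY
  obtain ⟨D', hD'⟩ := h.exists_hasFDerivAt Y
  have hn : (∞ : WithTop ℕ∞) ≠ 0 := by simp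
  have hcd : ContDiffAt ℝ ∞ D Y := h.contDiff.contDiffAt
  set g := hcd.localInverse hD' hn
  have hgY : g (D Y) = Y := hcd.localInverse_apply_image hD' hn
  have hasm : a.symm (e (P Y)) = D Y := by rw [ha.self_of_nhds.2, a.symm_apply_apply]
  have hs : ContMDiffAt (𝓡 n) 𝓘(ℝ, V) ∞ (fun y => g (a.symm (e y))) (P Y) := by
    have h1 : ContMDiffAt (𝓡 n) (𝓡 n) ∞ e (P Y) :=
      contMDiffAt_of_mem_maximalAtlas (IsManifold.chart_mem_maximalAtlas (I := 𝓡 n) (P Y)) heY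
    have h2 : ContDiff ℝ ∞ a.symm :=
      (a.symm : Rn n →ᵃ[ℝ] Rn n).contDiff_of_finiteDimensional
    have h3 : ContDiffAt ℝ ∞ g (a.symm (e (P Y))) := by
      rw [hasm]
      exact hcd.to_localInverse hD' hn
    exact (h3.comp _ h2.contDiffAt).contMDiffAt.comp (P Y) h1
  have hsY : g (a.symm (e (P Y))) = Y := by rw [hasm, hgY]
  refine ⟨fun y => g (a.symm (e y)), hsY, hs, ?_, ?_⟩
  · have hc1 : Filter.Tendsto (fun y => g (a.symm (e y))) (𝓝 (P Y)) (𝓝 Y) := by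
      have := hs.continuousAt.tendsto
      rwa [hsY] at this
    have hc2 : Filter.Tendsto (fun y => a.symm (e y)) (𝓝 (P Y)) (𝓝 (D Y)) := by
      rw [← hasm]
      exact ((a.symm : Rn n →ᵃ[ℝ] Rn n).continuous_of_finiteDimensional.continuousAt).tendsto.comp
        (e.continuousAt heY)
    have hinv : ∀ᶠ w in 𝓝 (D Y), D (g w) = w :=
      (hcd.hasStrictFDerivAt' hD' hn).eventually_right_inverse
    filter_upwards [hc1.eventually ha, hc2.eventually hinv, e.open_source.mem_nhds heY]
      with y h1 h2 h3
    refine e.injOn h1.1 h3 ?_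
    rw [h1.2, h2, a.apply_symm_apply]
  · have hinv : ∀ᶠ Z in 𝓝 Y, g (D Z) = Z :=
      (hcd.hasStrictFDerivAt' hD' hn).eventually_left_inverse
    filter_upwards [ha, hinv] with Z h1 h2
    rw [h1.2, a.symm_apply_apply, h2]

theorem isOpenMap [CompleteSpace V] [IsManifold (𝓡 n) ∞ M] (h : IsDevelopedBy D P) :
    IsOpenMap P := by
  rw [isOpenMap_iff_nhds_le]
  intro Y
  obtain ⟨s, hsY, hs, hPs, -⟩ := h.exists_local_section Y
  have hc : Filter.Tendsto s (𝓝 (P Y)) (𝓝 Y) := by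
    have := hs.continuousAt.tendsto
    rwa [hsY] at this
  calc 𝓝 (P Y) = Filter.map (fun y => P (s y)) (𝓝 (P Y)) := by
        rw [Filter.map_congr hPs, Filter.map_id']
    _ = Filter.map P (Filter.map s (𝓝 (P Y))) := by rw [Filter.map_map]; rfl
    _ ≤ Filter.map P (𝓝 Y) := Filter.map_mono hc

/-- Needed to lift geodesics from `M` to `V`; the fibres of `P` are the orbits of `Λ`. -/
theorem isCoveringMap [CompleteSpace V] [IsManifold (𝓡 n) ∞ M] (h : IsDevelopedBy D P)
    (hsurj : Function.Surjective P) (Λ : AddSubgroup V)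
    (hΛ : ∀ Y Z, P Y = P Z ↔ Z - Y ∈ Λ) : IsCoveringMap P := by
  have hcov : IsAddQuotientCoveringMap P Λ :=
    { toIsQuotientMap := h.isOpenMap.isQuotientMap h.contMDiff.continuous hsurj
      continuous_const_vadd := fun g => by
        simp only [AddSubgroup.vadd_def, vadd_eq_add]
        fun_prop
      apply_eq_iff_mem_orbit := by
        intro Y Z
        rw [eq_comm, hΛ]
        constructor
        · intro hmem
          exact ⟨⟨Y - Z, hmem⟩, by simp [AddSubgroup.vadd_def]⟩
        · rintro ⟨g, rfl⟩
          simp [AddSubgroup.vadd_def]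
      disjoint := by
        intro Y
        -- On the neighbourhood where `s ∘ P` is the identity, `P` is injective, so no nonzero
        -- element of `Λ` moves one of its points to another.
        obtain ⟨s, -, -, -, hs⟩ := h.exists_local_section Y
        refine ⟨_, hs, ?_⟩
        rintro g ⟨_, ⟨Z, hZ, rfl⟩, hgZ⟩
        have hP : P (g +ᵥ Z) = P Z := by
          rw [eq_comm, hΛ]
          simp [AddSubgroup.vadd_def]
        have h1 : s (P Z) = Z := hZ
        have h2 : s (P (g +ᵥ Z)) = g +ᵥ Z := hgZ
        rw [hP, h1] at h2
        have h3 : (g : V) + Z = Z := h2.symm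
        exact Subtype.ext (by simpa using h3) }
  exact hcov.isCoveringMap

end IsDevelopedBy

/-! ### Geodesics and surjectivity of the developing map. -/

/-- A curve in a normed space that is affine near each time is affine. -/
theorem eq_add_smul_of_eventually_eq_add_smul {E : Type*} [NormedAddCommGroup E]
    [NormedSpace ℝ E] {g : ℝ → E} {v : E}
    (hg : ∀ t, ∃ w : E, ∀ᶠ s in 𝓝 t, g s = g t + (s - t) • w)
    (hv : ∀ᶠ s in 𝓝 0, g s = g 0 + s • v) (t : ℝ) : g t = g 0 + t • v := by
  have hder : ∀ t w, (∀ᶠ s in 𝓝 t, g s = g t + (s - t) • w) →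
      ∀ᶠ s in 𝓝 t, HasDerivAt g w s := by
    intro t w h
    filter_upwards [h.eventually_nhds] with s hs
    have h1 : HasDerivAt (fun s : ℝ => g t + (s - t) • w) w s := by
      simpa using (((hasDerivAt_id s).sub_const t).smul_const w).const_add (g t)
    exact h1.congr_of_eventuallyEq hs
  -- The velocity is locally constant on the connected line, hence equal to its value `v` at `0`.
  have hloc : IsLocallyConstant (deriv g) := by
    rw [IsLocallyConstant.iff_eventually_eq]
    intro t
    obtain ⟨w, hw⟩ := hg t
    have h1 := hder t w hw
    filter_upwards [h1] with s hs
    rw [hs.deriv, h1.self_of_nhds.deriv]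
  have hdiff : Differentiable ℝ g := by
    intro t
    obtain ⟨w, hw⟩ := hg t
    exact (hder t w hw).self_of_nhds.differentiableAt
  have h0 : deriv g 0 = v := (hder 0 v (by simpa using hv)).self_of_nhds.deriv
  have hconst : ∀ s, HasDerivAt g v s := fun s => by
    rw [← h0, ← hloc.apply_eq_of_isPreconnected isPreconnected_univ (Set.mem_univ s) (Set.mem_univ 0)]
    exact (hdiff s).hasDerivAt
  have hsub : ∀ s, HasDerivAt (fun s => g s - s • v) 0 s := fun s => by
    have h := (hconst s).sub ((hasDerivAt_id s).smul_const v)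
    rw [one_smul, sub_self] at h
    exact h
  have := is_const_of_deriv_eq_zero (fun s => (hsub s).differentiableAt)
    (fun s => (hsub s).deriv) t 0
  rw [zero_smul, sub_zero, sub_eq_iff_eq_add] at this
  exact this

theorem IsAffineGeodesic.continuous {n : ℕ} {M : Type*} [TopologicalSpace M]
    [ChartedSpace (Rn n) M] {c : ℝ → M} (hc : IsAffineGeodesic n c) : Continuous c := by
  rw [continuous_iff_continuousAt]
  intro t
  set e := chartAt (Rn n) (c t)
  have he : c t ∈ e.source := mem_chart_source (Rn n) (c t)
  obtain ⟨v, hv⟩ := hc t e (chart_mem_atlas (Rn n) (c t)) he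
  have h1 : ContinuousAt (fun s : ℝ => e (c t) + (s - t) • v) t := by fun_prop
  have h2 : ContinuousAt (fun s : ℝ => e.symm (e (c t) + (s - t) • v)) t := by
    refine ContinuousAt.comp (f := fun s : ℝ => e (c t) + (s - t) • v) ?_ h1
    simpa using e.continuousAt_symm (e.map_source he)
  refine h2.congr ?_
  filter_upwards [hv] with s hs
  rw [← hs.2, e.left_inv hs.1]

/-- The developing map of a complete affine manifold is surjective. -/
theorem IsDevelopedBy.surjective_of_isAffineComplete {n : ℕ} {M V : Type*} [TopologicalSpace M]
    [ChartedSpace (Rn n) M] [NormedAddCommGroup V] [NormedSpace ℝ V] {D : V → Rn n} {P : V → M}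
    (h : IsDevelopedBy D P) (hP : IsCoveringMap P) (hcomplete : IsAffineComplete n M) :
    Function.Surjective D := by
  intro p
  set e := chartAt (Rn n) (P 0)
  have he : P 0 ∈ e.source := mem_chart_source (Rn n) (P 0)
  have hea : e ∈ atlas (Rn n) M := chart_mem_atlas (Rn n) (P 0)
  obtain ⟨a, ha⟩ := h.exists_affineEquiv 0 e hea he
  -- The velocity is chosen so that the lift of `c` from `0` develops to the line `D 0 + s (p - D
  -- 0)`, which reaches `p` at time `1`.
  obtain ⟨c, hc, hc0, hcv⟩ := hcomplete e hea (P 0) he (a.linear (p - D 0))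
  obtain ⟨F, ⟨hF0, hF⟩, -⟩ := hP.existsUnique_continuousMap_lifts ⟨c, hc.continuous⟩ 0 0 hc0.symm
  have hFc : ∀ s, P (F s) = c s := fun s => congrFun hF s
  have key : ∀ (t : ℝ) (e' : OpenPartialHomeomorph M (Rn n)) (b : Rn n ≃ᵃ[ℝ] Rn n) (w : Rn n),
      (∀ᶠ Z in 𝓝 (F t), P Z ∈ e'.source ∧ e' (P Z) = b (D Z)) →
      (∀ᶠ s in 𝓝 t, c s ∈ e'.source ∧ e' (c s) = e' (c t) + (s - t) • b.linear w) →
      ∀ᶠ s in 𝓝 t, D (F s) = D (F t) + (s - t) • w := by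
    intro t e' b w hb hw
    have hbt := hb.self_of_nhds.2
    filter_upwards [(F.continuous.tendsto t).eventually hb, hw] with s h1 h2
    refine b.injective ?_
    rw [← h1.2, hFc, h2.2, ← hFc t, hbt, add_comm (D (F t)), ← vadd_eq_add ((s - t) • w),
      b.map_vadd, map_smul, vadd_eq_add, add_comm]
  have hloc : ∀ t, ∃ w : Rn n, ∀ᶠ s in 𝓝 t, D (F s) = D (F t) + (s - t) • w := by
    intro t
    have het : c t ∈ (chartAt (Rn n) (c t)).source := mem_chart_source (Rn n) (c t)
    obtain ⟨b, hb⟩ := h.exists_affineEquiv (F t) _ (chart_mem_atlas (Rn n) (c t))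
      (by rw [hFc]; exact het)
    obtain ⟨w, hw⟩ := hc t _ (chart_mem_atlas (Rn n) (c t)) het
    exact ⟨b.linear.symm w, key t _ b _ hb (by simpa using hw)⟩
  have hv : ∀ᶠ s in 𝓝 (0 : ℝ), D (F s) = D (F 0) + s • (p - D 0) := by
    obtain ⟨w, hw⟩ := hc 0 e hea (hc0 ▸ he)
    have hw' : w = a.linear (p - D 0) := by
      refine HasDerivAt.unique ?_ hcv
      have h1 : HasDerivAt (fun s : ℝ => e (c 0) + (s - 0) • w) w 0 := by
        simpa using (((hasDerivAt_id (0 : ℝ)).sub_const 0).smul_const w).const_add (e (c 0))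
      exact h1.congr_of_eventuallyEq (hw.mono fun s hs => hs.2)
    subst hw'
    simpa using key 0 e a (p - D 0) (by rwa [hF0]) hw
  refine ⟨F 1, ?_⟩
  have := eq_add_smul_of_eventually_eq_add_smul (g := fun s => D (F s)) hloc hv 1
  simpa [hF0] using this

/-! ### Circle actions from translations along a primitive period. -/

theorem contMDiffAt_circle_arg (z : Circle) (hz : (z : ℂ) ∈ Complex.slitPlane) :
    ContMDiffAt (𝓡 1) 𝓘(ℝ, ℝ) ∞ (fun z : Circle => Complex.arg (z : ℂ)) z := by
  have : Fact (Module.finrank ℝ ℂ = 1 + 1) := ⟨Complex.finrank_real_complex⟩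
  have h1 : ContMDiffAt (𝓡 1) 𝓘(ℝ, ℂ) ∞ (fun z : Circle => (z : ℂ)) z :=
    (contMDiff_coe_sphere (E := ℂ) (n := 1)).contMDiffAt
  have h2 : ContDiffAt ℝ ∞ (fun w : ℂ => Complex.arg w) (z : ℂ) := by
    have h3 : ContDiffAt ℝ ∞ Complex.log (z : ℂ) :=
      (Complex.contDiffAt_log hz).restrict_scalars ℝ
    have h4 := Complex.imCLM.contDiff.contDiffAt.comp (z : ℂ) h3
    exact h4.congr_of_eventuallyEq (.of_forall fun w => (Complex.log_im w).symm)
  exact h2.contMDiffAt.comp z h1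

/-- Near each point of the circle there is a smooth angle function. -/
theorem exists_contMDiffAt_circle_angle (z₀ : Circle) :
    ∃ f : Circle → ℝ, ContMDiffAt (𝓡 1) 𝓘(ℝ, ℝ) ∞ f z₀ ∧ ∀ z, Circle.exp (f z) = z := by
  obtain ⟨θ, rfl⟩ := Circle.exp_surjective z₀
  refine ⟨fun z => θ + Complex.arg ((z * (Circle.exp θ)⁻¹ : Circle) : ℂ), ?_, fun z => ?_⟩
  · have h1 : ContMDiffAt (𝓡 1) (𝓡 1) ∞ (fun z : Circle => z * (Circle.exp θ)⁻¹) (Circle.exp θ) :=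
      contMDiffAt_id.mul contMDiffAt_const
    have h2 := contMDiffAt_circle_arg (Circle.exp θ * (Circle.exp θ)⁻¹) (by simp)
    exact contMDiffAt_const.add (ContMDiffAt.comp (Circle.exp θ) h2 h1)
  · rw [Circle.exp_add, Circle.exp_arg, mul_comm, inv_mul_cancel_right]

section CircleAction

variable {n : ℕ} {M V : Type*} [TopologicalSpace M] [ChartedSpace (Rn n) M]
  [NormedAddCommGroup V] [NormedSpace ℝ V] {D : V → Rn n} {P : V → M}

/-- If the developing map intertwines the translations along `u` with translations, and `u` is
a primitive period of `P`, then these translations induce a parallel circle action. -/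
theorem IsDevelopedBy.exists_isParallelCircleAction [CompleteSpace V] [IsManifold (𝓡 n) ∞ M]
    (h : IsDevelopedBy D P) (hsurj : Function.Surjective P) (Λ : AddSubgroup V)
    (hΛ : ∀ Y Z, P Y = P Z ↔ Z - Y ∈ Λ) (u : V) (w : Rn n)
    (hD : ∀ (Y : V) (t : ℝ), D (Y + t • u) = D Y + t • w)
    (hu : ∀ t : ℝ, t • u ∈ Λ ↔ ∃ k : ℤ, t = k) :
    ∃ _ : MulAction Circle M, IsParallelCircleAction n M := by
  have hpi : (2 * Real.pi) ≠ 0 := by positivity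
  -- The factor `2π` matches the period of `Circle.exp` with the period `1` of `t ↦ P (Y + t • u)`;
  -- changing the angle or the preimage only adds an element of `Λ`.
  have hwd : ∀ (θ θ' : ℝ) (Y Y' : V), Circle.exp θ = Circle.exp θ' → P Y = P Y' →
      P (Y + (θ / (2 * Real.pi)) • u) = P (Y' + (θ' / (2 * Real.pi)) • u) := by
    intro θ θ' Y Y' hθ hY
    obtain ⟨m, rfl⟩ := Circle.exp_eq_exp.1 hθ
    rw [hΛ] at hY ⊢
    have : Y' + (θ' / (2 * Real.pi)) • u - (Y + ((θ' + m * (2 * Real.pi)) / (2 * Real.pi)) • u)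
        = (Y' - Y) - (m : ℝ) • u := by
      rw [add_div, mul_div_cancel_right₀ _ hpi, add_smul]
      abel
    rw [this]
    exact Λ.sub_mem hY ((hu m).2 ⟨m, rfl⟩)
  let act : Circle → M → M := fun z y =>
    P (Function.surjInv hsurj y + (Complex.arg (z : ℂ) / (2 * Real.pi)) • u)
  have hact : ∀ (θ : ℝ) (Y : V), act (Circle.exp θ) (P Y) = P (Y + (θ / (2 * Real.pi)) • u) :=
    fun θ Y => hwd _ _ _ _ (Circle.exp_arg _) (Function.surjInv_eq hsurj _)
  let inst : MulAction Circle M :=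
    { smul := act
      one_smul := fun y => by
        obtain ⟨Y, rfl⟩ := hsurj y
        change act 1 (P Y) = P Y
        rw [← Circle.exp_zero, hact]
        simp
      mul_smul := fun z z' y => by
        obtain ⟨Y, rfl⟩ := hsurj y
        obtain ⟨θ, rfl⟩ := Circle.exp_surjective z
        obtain ⟨θ', rfl⟩ := Circle.exp_surjective z'
        change act (Circle.exp θ * Circle.exp θ') (P Y) = act (Circle.exp θ) (act _ (P Y))
        rw [← Circle.exp_add, hact (θ + θ') Y, hact θ' Y, hact θ, add_div, add_smul, add_assoc,
          add_comm ((θ / _) • u)] }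
  have hsmul : ∀ (θ : ℝ) (Y : V), Circle.exp θ • P Y = P (Y + (θ / (2 * Real.pi)) • u) := hact
  refine ⟨inst, ⟨?_, ⟨?_⟩, ?_⟩⟩
  · rintro ⟨z₀, y₀⟩
    obtain ⟨Y₀, rfl⟩ := hsurj y₀
    -- The choices made in `act` are not continuous; near a given point they can be replaced by a
    -- smooth angle and a smooth section.
    obtain ⟨f, hf, hfexp⟩ := exists_contMDiffAt_circle_angle z₀
    obtain ⟨s, hsY, hs, hPs, -⟩ := h.exists_local_section Y₀
    have h1 : ContMDiffAt ((𝓡 1).prod (𝓡 n)) 𝓘(ℝ, V) ∞ (fun q : Circle × M => s q.2)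
        (z₀, P Y₀) := ContMDiffAt.comp (z₀, P Y₀) hs contMDiffAt_snd
    have h2 : ContMDiffAt ((𝓡 1).prod (𝓡 n)) 𝓘(ℝ, ℝ) ∞ (fun q : Circle × M => f q.1)
        (z₀, P Y₀) := ContMDiffAt.comp (z₀, P Y₀) hf contMDiffAt_fst
    have h3 : ContDiff ℝ ∞ fun t : ℝ => (t / (2 * Real.pi)) • u := by fun_prop
    have h4 : ContMDiffAt ((𝓡 1).prod (𝓡 n)) 𝓘(ℝ, V) ∞
        (fun q : Circle × M => s q.2 + (f q.1 / (2 * Real.pi)) • u) (z₀, P Y₀) :=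
      h1.add (h3.contMDiff.contMDiffAt.comp (z₀, P Y₀) h2)
    refine (h.contMDiff.contMDiffAt.comp (z₀, P Y₀) h4).congr_of_eventuallyEq ?_
    filter_upwards [continuousAt_snd.eventually hPs] with q hq
    conv_lhs => rw [← hfexp q.1, ← hq]
    exact hsmul _ _
  · intro z z' hzz'
    obtain ⟨θ, rfl⟩ := Circle.exp_surjective z
    obtain ⟨θ', rfl⟩ := Circle.exp_surjective z'
    have h1 := hzz' (P 0)
    rw [hsmul, hsmul, hΛ, zero_add, zero_add, ← sub_smul, hu] at h1
    obtain ⟨k, hk⟩ := h1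
    rw [eq_comm, Circle.exp_eq_exp]
    refine ⟨k, ?_⟩
    rw [← hk]
    field_simp
    ring
  · intro e he x hx
    obtain ⟨Y₀, rfl⟩ := hsurj x
    obtain ⟨a, ha⟩ := h.exists_affineEquiv Y₀ e he hx
    obtain ⟨s, hsY, hs, hPs, -⟩ := h.exists_local_section Y₀
    have hc : Filter.Tendsto s (𝓝 (P Y₀)) (𝓝 Y₀) := by
      have := hs.continuousAt.tendsto
      rwa [hsY] at this
    refine ⟨(1 / (2 * Real.pi)) • a.linear w, ?_⟩
    filter_upwards [hc.eventually ha.eventually_nhds, hPs] with y h1 h2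
    have hθ : Filter.Tendsto (fun θ : ℝ => s y + (θ / (2 * Real.pi)) • u) (𝓝 0) (𝓝 (s y)) := by
      have : ContinuousAt (fun θ : ℝ => s y + (θ / (2 * Real.pi)) • u) 0 := by fun_prop
      simpa [ContinuousAt] using this
    have hder : HasDerivAt (fun θ : ℝ => (θ / (2 * Real.pi)) • a.linear w + a (D (s y)))
        ((1 / (2 * Real.pi)) • a.linear w) 0 :=
      (((hasDerivAt_id (0 : ℝ)).div_const _).smul_const _).add_const _
    refine hder.congr_of_eventuallyEq ?_
    filter_upwards [hθ.eventually h1] with θ hθ'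
    conv_lhs => rw [← h2]
    rw [hsmul, hθ'.2, hD, add_comm, ← vadd_eq_add, a.map_vadd, map_smul, vadd_eq_add]

end CircleAction

/-! ### The rational annihilator and the integer lattice. -/

/-- Multiplication by `Z` on the right in `aff(ℝⁿ)`. -/
noncomputable def affMulRight {n : ℕ} (Z : AffLie n) : AffLie n →ₗ[ℝ] AffLie n where
  toFun Y := affMul Y Z
  map_add' Y W := by simp [affMul]
  map_smul' r Y := by simp [affMul]

theorem affMul_smul {n : ℕ} (r : ℝ) (Y Z : AffLie n) : affMul Y (r • Z) = r • affMul Y Z := by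
  simp [affMul]

theorem affLie_smul_zero {n : ℕ} (r : ℝ) : r • (0 : AffLie n) = 0 :=
  Prod.ext (smul_zero (A := Rn n →L[ℝ] Rn n) r) (smul_zero (A := Rn n) r)

theorem affComb_single {n : ℕ} (X : Fin n → AffLie n) (i : Fin n) (r : ℝ) :
    affComb X (Pi.single i r) = r • X i := by
  rw [affComb, Fintype.linearCombination_apply_single]

theorem affComb_injective {n : ℕ} {X : Fin n → AffLie n} (hX : LinearIndependent ℝ X) :
    Function.Injective (affComb X) :=
  hX.fintypeLinearCombination_injective

/-- A commutative rational algebra of nilpotent affine vector fields has a nonzero annihilator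
with unimodular integer coordinates. -/
theorem exists_unimodular_annihilator {n : ℕ} (hn : 1 ≤ n) {X : Fin n → AffLie n}
    (hX : LinearIndependent ℝ X) (hrat : IsRationalAlgebra X)
    (hcomm : ∀ s t, affMul (affComb X s) (affComb X t) = affMul (affComb X t) (affComb X s))
    (hnil : ∀ i, IsNilpotent (affLift (X i))) :
    ∃ m a : Fin n → ℤ, ∑ i, a i * m i = 1 ∧
      ∀ t, affMul (affComb X t) (affComb X fun i => (m i : ℝ)) = 0 := by
  have hXi : ∀ i, affComb X (Pi.single i 1) = X i := fun i => by rw [affComb_single, one_smul]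
  have hmem : ∀ i, X i ∈ ratSpan X := fun i => by
    refine ⟨Pi.single i 1, ?_⟩
    rw [← hXi i, affComb_apply]
    refine Finset.sum_congr rfl fun j _ => ?_
    congr 1
    by_cases h : j = i
    · subst h; simp
    · simp [h]
  -- Rationality enters here: the search stays inside the rational span, so the annihilator has
  -- rational coordinates `q`.
  obtain ⟨_, ⟨Z, ⟨q, rfl⟩, rfl⟩, hZ0, hZ⟩ := exists_ne_zero_forall_mul_eq_zero
    (affLift '' ratSpan X) (fun i => affLift (X i))
    (by
      rintro i _ ⟨Y, hY, rfl⟩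
      exact ⟨_, hrat _ (hmem i) Y hY, affLift_mul _ _⟩)
    hnil (fun i j => commute_affLift (by rw [← hXi i, ← hXi j, hcomm]))
    ⟨_, ⟨_, hmem ⟨0, hn⟩, rfl⟩, affLift_ne_zero (hX.ne_zero _)⟩
  have hq : q ≠ 0 := by
    rintro rfl
    refine hZ0 ?_
    have h0 : affComb X 0 = ∑ i, (((0 : Fin n → ℚ) i : ℚ) : ℝ) • X i := by
      simp only [affComb_apply, Pi.zero_apply, Rat.cast_zero]
    refine (congrArg affLift h0.symm).trans ?_
    rw [map_zero]
    exact (affLiftLinear n).map_zero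
  obtain ⟨r, m, a, -, hm, ha⟩ := exists_unimodular_eq_mul q hq
  refine ⟨m, a, ha, fun t => ?_⟩
  have hmq : affComb X (fun i => (m i : ℝ)) = (r : ℝ) • ∑ i, (q i : ℝ) • X i := by
    rw [affComb_apply, Finset.smul_sum]
    refine Finset.sum_congr rfl fun i _ => ?_
    rw [smul_smul]
    congr 1
    exact_mod_cast hm i
  have hXZ : ∀ i, affMulRight (∑ i, (q i : ℝ) • X i) (X i) = 0 := fun i =>
    affLift_injective ((affLift_mul _ _).trans ((hZ i).trans (affLiftLinear n).map_zero.symm))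
  have htZ : affMul (affComb X t) (∑ i, (q i : ℝ) • X i) = 0 := by
    change affMulRight _ _ = 0
    rw [affComb_apply, map_sum]
    exact Finset.sum_eq_zero fun i _ => by
      rw [map_smul, hXZ]
      exact affLie_smul_zero _
  rw [hmq, affMul_smul, htZ]
  exact affLie_smul_zero _

/-- The vectors with integer coordinates. -/
def integerVectors (n : ℕ) : AddSubgroup (Fin n → ℝ) where
  carrier := {v | ∃ m : Fin n → ℤ, ∀ i, v i = m i}
  zero_mem' := ⟨0, by simp⟩
  add_mem' := by
    rintro _ _ ⟨m, hm⟩ ⟨k, hk⟩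
    exact ⟨m + k, fun i => by simp [hm, hk]⟩
  neg_mem' := by
    rintro _ ⟨m, hm⟩
    exact ⟨-m, fun i => by simp [hm]⟩

/-- Pairing with the Bézout coefficients `a` recovers `t` from `t • m` as an integer. -/
theorem smul_mem_integerVectors_iff {n : ℕ} {m a : Fin n → ℤ} (h : ∑ i, a i * m i = 1) (t : ℝ) :
    t • (fun i => (m i : ℝ)) ∈ integerVectors n ↔ ∃ k : ℤ, t = k := by
  constructor
  · rintro ⟨p, hp⟩
    refine ⟨∑ i, a i * p i, ?_⟩
    have h' : ∑ i, (a i : ℝ) * m i = 1 := by exact_mod_cast h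
    push_cast
    calc t = t * ∑ i, (a i : ℝ) * m i := by rw [h', mul_one]
      _ = ∑ i, (a i : ℝ) * p i := by
        rw [Finset.mul_sum]
        refine Finset.sum_congr rfl fun i _ => ?_
        rw [← hp i, Pi.smul_apply, smul_eq_mul]
        ring
  · rintro ⟨k, rfl⟩
    exact ⟨fun i => k * m i, fun i => by simp⟩

/-! ### The circle action on `M`. -/

theorem proposition3p3 (n : ℕ) (hn : 1 ≤ n) (M : Type*) [TopologicalSpace M]
    [ChartedSpace (Rn n) M] [HasGroupoid M (affineGroupoid n)]
    (hcomplete : IsAffineComplete n M)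
    (htorus : Nonempty (Diffeomorph (𝓡 n) (ModelWithCorners.pi fun _ : Fin n => 𝓡 1)
      M (Fin n → Circle) ∞))
    (𝓗 : Submodule ℝ (AffLie n)) (X : Fin n → AffLie n)
    (hdef : IsDefinedByAlgebra n M 𝓗 X) (hrat : IsRationalAlgebra X) :
    ∃ _ : MulAction Circle M, IsParallelCircleAction n M := by
  have : IsManifold (𝓡 n) ∞ M := isManifold_of_hasGroupoid_affineGroupoid n M
  obtain ⟨hmul, hcomm, hX, hspan, x₀, P, hx₀, hPsurj, hPeq, hPchart⟩ := hdef
  have hmem : ∀ t, affComb X t ∈ 𝓗 := fun t => by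
    rw [← hspan, ← Fintype.range_linearCombination]
    exact ⟨t, rfl⟩
  have hex : ∀ Y ∈ 𝓗, ∃ t, affComb X t = Y := fun Y hY => by
    rwa [← hspan, ← Fintype.range_linearCombination] at hY
  have hcomm' : ∀ s t, affMul (affComb X s) (affComb X t) = affMul (affComb X t) (affComb X s) :=
    fun s t => hcomm _ (hmem s) _ (hmem t)
  have hbij : Function.Bijective (affEval 𝓗 x₀) := hx₀
  -- In coordinates with respect to the basis `X`, the lattice becomes the integer vectors.
  let T : (Fin n → ℝ) → 𝓗 := fun t => ⟨affComb X t, hmem t⟩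
  have hTcont : Continuous T :=
    (affComb X).continuous_of_finiteDimensional.subtype_mk hmem
  let D : (Fin n → ℝ) → Rn n := fun t => affExp (affComb X t) x₀
  have hdev : IsDevelopedBy D (P ∘ T) :=
    { contDiff := contDiff_affExp_affComb X x₀
      exists_hasFDerivAt := exists_hasFDerivAt_affExp_affComb hcomm' fun t ht =>
        affComb_injective hX (by
          rw [map_zero]
          exact congrArg Subtype.val (hbij.1 (ht.trans (affEval 𝓗 x₀).map_zero.symm) : T t = 0))
      exists_affineEquiv := fun t e he hte => by
        obtain ⟨a, ha⟩ := hPchart (T t) e he hte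
        exact ⟨a, (hTcont.tendsto t).eventually ha⟩ }
  have hsurj : Function.Surjective (P ∘ T) := by
    intro y
    obtain ⟨Y, rfl⟩ := hPsurj y
    obtain ⟨t, ht⟩ := hex Y.1 Y.2
    exact ⟨t, congrArg P (Subtype.ext ht)⟩
  have hΛ : ∀ s t, (P ∘ T) s = (P ∘ T) t ↔ t - s ∈ integerVectors n := by
    intro s t
    refine (hPeq (T s) (T t)).trans (exists_congr fun m => ?_)
    rw [← affComb_apply X fun i => (m i : ℝ)]
    change affComb X t - affComb X s = _ ↔ _
    rw [← map_sub, (affComb_injective hX).eq_iff, funext_iff]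
  have hDsurj : Function.Surjective D := hdev.surjective_of_isAffineComplete
    (hdev.isCoveringMap hsurj _ hΛ) hcomplete
  have hnil : ∀ i, IsNilpotent (affLift (X i)) := by
    intro i
    refine isNilpotent_affLift_of_surjective hmul hcomm hbij.1 (fun p => ?_)
      ⟨X i, hspan ▸ Submodule.subset_span ⟨i, rfl⟩⟩
    obtain ⟨t, ht⟩ := hDsurj p
    exact ⟨T t, ht⟩
  obtain ⟨m, a, ham, hann⟩ := exists_unimodular_annihilator hn hX hrat hcomm' hnil
  refine hdev.exists_isParallelCircleAction hsurj (integerVectors n) hΛ (fun i => (m i : ℝ))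
    ((affComb X fun i => (m i : ℝ)).1 x₀ + (affComb X fun i => (m i : ℝ)).2) (fun t r => ?_)
    (smul_mem_integerVectors_iff ham)
  set u : Fin n → ℝ := fun i => (m i : ℝ)
  have hann' : ∀ s, affMul (affComb X s) (affComb X (r • u)) = 0 := fun s => by
    rw [map_smul, affMul_smul, hann]
    exact affLie_smul_zero _
  change affExp (affComb X (t + r • u)) x₀ = affExp (affComb X t) x₀ + _
  rw [map_add, affExp_add_of_affMul_eq_zero (hann' t) ((hcomm' _ _).trans (hann' t)) (hann' _),
    map_smul, smul_add]
  rfl
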